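/- Let $\zeta$ be the Riemann zeta function (analytically continued), and write $1/\zeta$ for its reciprocal, with the value $1/\zeta(1)=0$ at the pole of $\zeta$. For $n\in\mathbb{N}_0$ and $\alpha\in\mathbb{C}$ let $$P_n(\alpha)=(-1)^n\binom{\alpha}{n}=\frac{(-1)^n}{n!}\prod_{m=0}^{n-1}(\alpha-m).$$ Then for every $s\in\mathbb{C}$ with $\operatorname{Re}(s)>1$, $$\frac{1}{\zeta(s)}=\sum_{n=0}^{\infty}\left[\sum_{k=0}^{n}P_k(n)\,\frac{1}{\zeta(k)}\right]P_n(s),$$ where the series over $n$ converges absolutely. -/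

import Mathlib

noncomputable section

/-- The `n`-th Pochhammer–Newton polynomial
`P_n(α) = (-1)^n binom(α, n) = ((-1)^n / n!) ∏_{m=0}^{n-1} (α - m)`. -/
def pochhammerNewton (n : ℕ) (α : ℂ) : ℂ :=
  (-1) ^ n / (n.factorial : ℂ) * ∏ m ∈ Finset.range n, (α - (m : ℂ))

/-- The reciprocal Riemann zeta function `1/ζ`. Since `ζ` has a pole at `1`, the value of `1/ζ`
there is `0` (Mathlib's `riemannZeta 1` is an arbitrary finite number, hence the case split). -/
def recipZeta (s : ℂ) : ℂ :=
  if s = 1 then 0 else 1 / riemannZeta s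

end

/-!
Write `1/ζ(s) = ∑ μ(m) x^s` with `x = 1/m`. For each `x ∈ [0, 1]` the binomial series
`x^s = ∑ (1 - x)^n P_n(s)` is the Newton series of `s ↦ x^s`, because
`(1 - x)^n = ∑_{k ≤ n} P_k(n) x^k`; it remains to sum over `m` under `∑_n`.

The double series does not converge absolutely as it stands. However
`∑_n P_k(n) P_n(s) = 0` for `k < Re s`, so a Newton series at `s` ignores the nodes `k < Re s`.
With `K + 1` the first node `≥ Re s`, drop the terms with `k ≤ K` from `∑_k P_k(n) x^k`. What is
left is the binomial remainder, at most `min((n x)^K, (n x)^(K+1)) ≤ (n x)^c` in absolute value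
for `K ≤ c ≤ K + 1`. Since `P_n(s) = O(n^(-Re s - 1))`, any `c < Re s` beyond the abscissa of
absolute convergence makes the double series converge absolutely.
-/

open Filter Topology Asymptotics Finset

lemma pochhammerNewton_eq_choose (n : ℕ) (s : ℂ) :
    pochhammerNewton n s = (-1) ^ n * Ring.choose s n := by
  rw [Ring.choose_eq_smul, Polynomial.descPochhammer_smeval_eq_ascPochhammer,
    Polynomial.ascPochhammer_smeval_cast, Polynomial.ascPochhammer_smeval_eq_eval,
    ← descPochhammer_eval_eq_ascPochhammer, descPochhammer_eval_eq_prod_range,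
    pochhammerNewton, smul_eq_mul]
  ring

lemma pochhammerNewton_natCast (k n : ℕ) :
    pochhammerNewton k (n : ℂ) = (-1) ^ k * (n.choose k : ℂ) := by
  rw [pochhammerNewton_eq_choose, Ring.choose_natCast]

lemma pochhammerNewton_natCast_of_lt {k n : ℕ} (h : n < k) : pochhammerNewton k (n : ℂ) = 0 := by
  rw [pochhammerNewton_natCast, Nat.choose_eq_zero_of_lt h, Nat.cast_zero, mul_zero]

lemma sum_range_succ_pochhammerNewton (n : ℕ) (s : ℂ) :
    ∑ k ∈ range (n + 1), pochhammerNewton k s = pochhammerNewton n (s - 1) := by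
  induction n with
  | zero => simp [pochhammerNewton]
  | succ n ih =>
    have pascal := Ring.choose_succ_succ (s - 1) n
    rw [sub_add_cancel] at pascal
    rw [sum_range_succ, ih]
    simp only [pochhammerNewton_eq_choose, pascal]
    ring

lemma pochhammerNewton_natCast_mul_pochhammerNewton (k j : ℕ) (s : ℂ) :
    pochhammerNewton k ((j + k : ℕ) : ℂ) * pochhammerNewton (j + k) s =
      Ring.choose s k * pochhammerNewton j (s - k) := by
  have h := Ring.choose_smul_choose s (Nat.le_add_left k j)
  rw [nsmul_eq_mul, Nat.add_sub_cancel] at h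
  have hsign : (-1 : ℂ) ^ k * (-1) ^ (j + k) = (-1) ^ j := by
    rw [pow_add, mul_left_comm, ← mul_pow, neg_one_mul, neg_neg, one_pow, mul_one]
  rw [pochhammerNewton_natCast, mul_comm, pochhammerNewton_eq_choose, pochhammerNewton_eq_choose,
    ← hsign]
  linear_combination (-1) ^ k * (-1) ^ (j + k) * h

-- For `s ∈ {0, …, n}` the sequence `GammaSeq (-s) n` takes the junk value `x / 0 = 0`; both sides
-- are then `0`.
lemma pochhammerNewton_mul_natCast_sub (s : ℂ) {n : ℕ} (hn : n ≠ 0) :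
    pochhammerNewton n s * (n - s) = (n : ℂ) ^ (-s) * (Complex.GammaSeq (-s) n)⁻¹ := by
  have hfactorial : (n.factorial : ℂ) ≠ 0 := by exact_mod_cast n.factorial_ne_zero
  have hpow : (n : ℂ) ^ (-s) ≠ 0 := by simp [Complex.cpow_eq_zero_iff, hn]
  have hprod : ∏ j ∈ range n, (-s + (j : ℂ)) = (-1) ^ n * ∏ j ∈ range n, (s - (j : ℂ)) := by
    simpa [sub_eq_neg_add, add_comm] using prod_neg (s := range n) (fun j : ℕ => s - (j : ℂ))
  rw [Complex.GammaSeq, prod_range_succ, hprod, inv_div, pochhammerNewton]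
  field_simp
  ring

lemma isBigO_pochhammerNewton (s : ℂ) :
    (fun n : ℕ => pochhammerNewton n s) =O[atTop] fun n : ℕ => (n : ℝ) ^ (-s.re - 1) := by
  by_cases hs : ∃ k : ℕ, s = k
  · obtain ⟨k, rfl⟩ := hs
    refine EventuallyEq.trans_isBigO ?_ (isBigO_zero _ _)
    filter_upwards [eventually_gt_atTop k] with n hn using pochhammerNewton_natCast_of_lt hn
  push Not at hs
  have hGamma : (fun n => (Complex.GammaSeq (-s) n)⁻¹) =O[atTop] fun _ => (1 : ℝ) :=
    ((Complex.GammaSeq_tendsto_Gamma (-s)).inv₀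
      (Complex.Gamma_ne_zero fun m h => hs m (neg_injective h))).isBigO_one ℝ
  have hpow : (fun n : ℕ => (n : ℂ) ^ (-s)) =O[atTop] fun n : ℕ => (n : ℝ) ^ (-s.re) := by
    refine IsBigO.of_bound' ?_
    filter_upwards [eventually_gt_atTop 0] with n hn
    rw [Complex.norm_natCast_cpow_of_pos hn, Complex.neg_re]
    exact le_abs_self _
  have hsub : (fun n : ℕ => (n : ℂ)) =O[atTop] fun n : ℕ => (n : ℂ) - s := by
    refine IsLittleO.right_isBigO_sub (isLittleO_const_left.mpr (.inr ?_))
    simpa [Function.comp_def] using tendsto_natCast_atTop_atTop (R := ℝ)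
  have hmul : (fun n : ℕ => pochhammerNewton n s * n) =O[atTop]
      fun n : ℕ => (n : ℝ) ^ (-s.re) * 1 := by
    refine ((isBigO_refl _ _).mul hsub).trans (EventuallyEq.trans_isBigO ?_ (hpow.mul hGamma))
    filter_upwards [eventually_ne_atTop 0] with n hn using pochhammerNewton_mul_natCast_sub s hn
  have hinv : (fun n : ℕ => (n : ℂ)⁻¹) =O[atTop] fun n : ℕ => (n : ℝ)⁻¹ :=
    IsBigO.of_bound' (.of_forall fun n => by simp)
  refine (hmul.mul hinv).congr' ?_ ?_
  · filter_upwards [eventually_ne_atTop 0] with n hn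
    exact mul_inv_cancel_right₀ (by exact_mod_cast hn) _
  · filter_upwards [eventually_ne_atTop 0] with n hn
    rw [mul_one, Real.rpow_sub_one (by exact_mod_cast hn), div_eq_mul_inv]

lemma summable_rpow_mul_norm_pochhammerNewton {s : ℂ} {c : ℝ} (hc : c < s.re) :
    Summable fun n : ℕ => (n : ℝ) ^ c * ‖pochhammerNewton n s‖ := by
  have hexp : c + (-s.re - 1) < -1 := by linarith
  refine summable_of_isBigO_nat (Real.summable_nat_rpow.mpr hexp)
    (((isBigO_refl _ _).mul (isBigO_pochhammerNewton s).norm_left).congr' .rfl ?_)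
  filter_upwards [eventually_gt_atTop 0] with n hn
  rw [Real.rpow_add (by exact_mod_cast hn)]

lemma tendsto_pochhammerNewton_zero {s : ℂ} (hs : -1 < s.re) :
    Tendsto (fun n : ℕ => pochhammerNewton n s) atTop (𝓝 0) := by
  have hexp : 0 < s.re + 1 := by linarith
  refine (isBigO_pochhammerNewton s).trans_tendsto ?_
  convert! (tendsto_rpow_neg_atTop hexp).comp tendsto_natCast_atTop_atTop using 2
  simp [sub_eq_add_neg, add_comm]

lemma hasSum_pochhammerNewton {s : ℂ} (hs : 0 < s.re) :
    HasSum (fun n : ℕ => pochhammerNewton n s) 0 := by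
  have hsum : Summable fun n : ℕ => pochhammerNewton n s :=
    .of_norm (by simpa using summable_rpow_mul_norm_pochhammerNewton hs)
  rw [hsum.hasSum_iff_tendsto_nat, ← tendsto_add_atTop_iff_nat 1]
  simp only [sum_range_succ_pochhammerNewton]
  exact tendsto_pochhammerNewton_zero (by simpa using hs)

lemma hasSum_pochhammerNewton_natCast_mul_pochhammerNewton {k : ℕ} {s : ℂ} (hk : k < s.re) :
    HasSum (fun n : ℕ => pochhammerNewton k (n : ℂ) * pochhammerNewton n s) 0 := by
  rw [← hasSum_nat_add_iff' k]
  have hhead : ∑ n ∈ range k, pochhammerNewton k (n : ℂ) * pochhammerNewton n s = 0 :=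
    sum_eq_zero fun n hn => by rw [pochhammerNewton_natCast_of_lt (mem_range.mp hn), zero_mul]
  have htail := (hasSum_pochhammerNewton (s := s - k) (by simpa using hk)).mul_left
    (Ring.choose s k)
  simpa only [hhead, sub_zero, mul_zero, pochhammerNewton_natCast_mul_pochhammerNewton] using htail

lemma hasSum_one_sub_pow_mul_pochhammerNewton (s : ℂ) {z : ℂ} (hz : ‖1 - z‖ < 1) :
    HasSum (fun n : ℕ => (1 - z) ^ n * pochhammerNewton n s) (z ^ s) := by
  have h := Complex.one_add_cpow_hasFPowerSeriesOnBall_zero (a := s).hasSum (y := z - 1) (by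
    rwa [← ENNReal.ofReal_one, Metric.eball_ofReal, mem_ball_zero_iff, norm_sub_rev])
  rw [zero_add, add_sub_cancel] at h
  convert! h using 2 with n
  rw [pochhammerNewton_eq_choose, binomialSeries_apply, List.ofFn_const, List.prod_replicate,
    smul_eq_mul, ← neg_sub z 1, neg_pow, mul_mul_mul_comm, ← mul_pow]
  simp [mul_comm]

/-- The coefficient `∑_{k=0}^n P_k(n) f(k)`, that is `(-1)^n (Δ^n f)(0)`, of `P_n` in the Newton
series interpolating `f` at the natural numbers. -/
noncomputable def newtonCoeff (f : ℕ → ℂ) (n : ℕ) : ℂ :=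
  ∑ k ∈ range (n + 1), pochhammerNewton k (n : ℂ) * f k

lemma newtonCoeff_eq_sum_range (f : ℕ → ℂ) {n N : ℕ} (h : n < N) :
    newtonCoeff f n = ∑ k ∈ range N, pochhammerNewton k (n : ℂ) * f k := by
  refine sum_subset (range_mono h) fun k _ hk => ?_
  rw [pochhammerNewton_natCast_of_lt (by simpa using hk), zero_mul]

lemma newtonCoeff_const_mul (a : ℂ) (f : ℕ → ℂ) (n : ℕ) :
    newtonCoeff (fun k => a * f k) n = a * newtonCoeff f n := by
  simp only [newtonCoeff, mul_sum, mul_left_comm]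

lemma newtonCoeff_pow (z : ℂ) (n : ℕ) : newtonCoeff (fun k => z ^ k) n = (1 - z) ^ n := by
  rw [sub_eq_neg_add, add_pow, newtonCoeff]
  refine sum_congr rfl fun k _ => ?_
  rw [pochhammerNewton_natCast, neg_pow z, one_pow]
  ring

lemma newtonCoeff_indicator_Ici (K : ℕ) (f : ℕ → ℂ) (n : ℕ) :
    newtonCoeff ((Set.Ici K).indicator f) n =
      newtonCoeff f n - ∑ k ∈ range K, pochhammerNewton k (n : ℂ) * f k := by
  have hn : n < K + (n + 1) := by lia
  have hhead : ∑ k ∈ range K, pochhammerNewton k (n : ℂ) * (Set.Ici K).indicator f k = 0 :=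
    sum_eq_zero fun k hk => by rw [Set.indicator_of_notMem (by simpa using hk), mul_zero]
  rw [newtonCoeff_eq_sum_range _ hn, newtonCoeff_eq_sum_range _ hn,
    sum_range_add _ K, sum_range_add _ K, hhead, zero_add, add_sub_cancel_left]
  simp only [Set.indicator_of_mem (Set.mem_Ici.mpr (Nat.le_add_right K _))]

lemma hasSum_newtonCoeff {ι : Type*} {g : ι → ℕ → ℂ} {f : ℕ → ℂ}
    (h : ∀ k, HasSum (fun i => g i k) (f k)) (n : ℕ) :
    HasSum (fun i => newtonCoeff (g i) n) (newtonCoeff f n) :=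
  hasSum_sum fun k _ => (h k).mul_left _

lemma hasSum_newtonCoeff_indicator_Ici_iff {K : ℕ} {f : ℕ → ℂ} {s L : ℂ}
    (hK : ∀ k < K, (k : ℝ) < s.re) :
    HasSum (fun n => newtonCoeff ((Set.Ici K).indicator f) n * pochhammerNewton n s) L ↔
      HasSum (fun n => newtonCoeff f n * pochhammerNewton n s) L := by
  have hhead : HasSum (fun n : ℕ =>
      (∑ k ∈ range K, pochhammerNewton k (n : ℂ) * f k) * pochhammerNewton n s) 0 := by
    have h := hasSum_sum fun k hk => (hasSum_pochhammerNewton_natCast_mul_pochhammerNewton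
      (hK k (mem_range.mp hk))).mul_right (f k)
    simpa only [zero_mul, sum_const_zero, sum_mul, mul_right_comm] using h
  simp only [newtonCoeff_indicator_Ici, sub_mul]
  exact ⟨fun h => by simpa using h.add hhead, fun h => by simpa using h.sub hhead⟩

lemma hasSum_newtonCoeff_pow_mul_pochhammerNewton {s : ℂ} (hs : 0 < s.re) {x : ℝ}
    (hx : x ∈ Set.Icc 0 1) :
    HasSum (fun n => newtonCoeff (fun k => (x : ℂ) ^ k) n * pochhammerNewton n s)
      ((x : ℂ) ^ s) := by
  simp only [newtonCoeff_pow]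
  rcases hx.1.eq_or_lt with rfl | hx0
  · have hs0 : s ≠ 0 := by rintro rfl; simp at hs
    simpa [Complex.zero_cpow hs0] using hasSum_pochhammerNewton hs
  · refine hasSum_one_sub_pow_mul_pochhammerNewton s ?_
    rw [← Complex.ofReal_one, ← Complex.ofReal_sub, Complex.norm_real,
      Real.norm_of_nonneg (sub_nonneg.mpr hx.2)]
    linarith

/-- `(-1)^K` times the error of the binomial expansion of `(1 - x)^n` truncated to its first `K`
terms; the sign makes it nonnegative on `[0, 1]`. -/
def binomialRemainder (K n : ℕ) (x : ℝ) : ℝ :=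
  (-1) ^ K * ((1 - x) ^ n - ∑ k ∈ range K, (-1) ^ k * n.choose k * x ^ k)

lemma newtonCoeff_indicator_Ici_pow (K n : ℕ) (x : ℝ) :
    newtonCoeff ((Set.Ici K).indicator fun k => (x : ℂ) ^ k) n =
      (-1) ^ K * binomialRemainder K n x := by
  rw [newtonCoeff_indicator_Ici, newtonCoeff_pow, binomialRemainder]
  simp only [pochhammerNewton_natCast]
  push_cast
  rw [← mul_assoc, ← mul_pow, neg_one_mul, neg_neg, one_pow, one_mul]

lemma binomialRemainder_zero (n : ℕ) (x : ℝ) : binomialRemainder 0 n x = (1 - x) ^ n := by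
  simp [binomialRemainder]

lemma binomialRemainder_succ (K n : ℕ) (x : ℝ) :
    binomialRemainder (K + 1) n x = n.choose K * x ^ K - binomialRemainder K n x := by
  have hsign : (-1 : ℝ) ^ K * (-1) ^ K = 1 := by rw [← mul_pow, neg_one_mul, neg_neg, one_pow]
  rw [binomialRemainder, binomialRemainder, sum_range_succ, pow_succ]
  linear_combination (n.choose K * x ^ K) * hsign

lemma binomialRemainder_succ_zero (K : ℕ) (x : ℝ) : binomialRemainder (K + 1) 0 x = 0 := by
  induction K with
  | zero => simp [binomialRemainder]
  | succ K ih => rw [binomialRemainder_succ, ih]; simp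

lemma binomialRemainder_succ_succ (K n : ℕ) (x : ℝ) :
    binomialRemainder (K + 1) (n + 1) x =
      binomialRemainder (K + 1) n x + x * binomialRemainder K n x := by
  induction K with
  | zero =>
    simp only [binomialRemainder_succ, binomialRemainder_zero, Nat.choose_zero_right]
    ring
  | succ K ih =>
    rw [binomialRemainder_succ (K + 1) (n + 1), ih, Nat.choose_succ_succ]
    push_cast
    linear_combination -binomialRemainder_succ (K + 1) n x - x * binomialRemainder_succ K n x

lemma binomialRemainder_nonneg (K n : ℕ) {x : ℝ} (hx : x ∈ Set.Icc 0 1) :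
    0 ≤ binomialRemainder K n x := by
  induction n generalizing K with
  | zero =>
    cases K with
    | zero => simp [binomialRemainder_zero]
    | succ K => rw [binomialRemainder_succ_zero]
  | succ n ih =>
    cases K with
    | zero => rw [binomialRemainder_zero]; exact pow_nonneg (sub_nonneg.mpr hx.2) _
    | succ K =>
      rw [binomialRemainder_succ_succ]
      exact add_nonneg (ih _) (mul_nonneg hx.1 (ih _))

lemma choose_mul_pow_le_mul_pow (n k : ℕ) {x : ℝ} (hx : 0 ≤ x) :
    n.choose k * x ^ k ≤ (n * x) ^ k := by
  rw [mul_pow]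
  gcongr
  exact_mod_cast Nat.choose_le_pow n k

lemma binomialRemainder_le_pow (K n : ℕ) {x : ℝ} (hx : x ∈ Set.Icc 0 1) :
    binomialRemainder K n x ≤ (n * x) ^ K := by
  have hnext := binomialRemainder_nonneg (K + 1) n hx
  rw [binomialRemainder_succ] at hnext
  linarith [choose_mul_pow_le_mul_pow n K hx.1]

lemma binomialRemainder_succ_le_pow (K n : ℕ) {x : ℝ} (hx : x ∈ Set.Icc 0 1) :
    binomialRemainder (K + 1) n x ≤ (n * x) ^ K := by
  rw [binomialRemainder_succ]
  linarith [choose_mul_pow_le_mul_pow n K hx.1, binomialRemainder_nonneg K n hx]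

lemma binomialRemainder_succ_le_rpow {K : ℕ} (n : ℕ) {x c : ℝ} (hx : x ∈ Set.Icc 0 1)
    (hKc : K ≤ c) (hcK : c ≤ K + 1) :
    binomialRemainder (K + 1) n x ≤ (n : ℝ) ^ c * x ^ c := by
  have hy : 0 ≤ n * x := mul_nonneg n.cast_nonneg hx.1
  rw [← Real.mul_rpow n.cast_nonneg hx.1]
  rcases le_total (n * x) 1 with h | h
  · calc binomialRemainder (K + 1) n x ≤ (n * x) ^ (K + 1) := binomialRemainder_le_pow _ n hx
      _ = (n * x) ^ ((K : ℝ) + 1) := by rw [← Nat.cast_add_one, Real.rpow_natCast]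
      _ ≤ (n * x) ^ c := Real.rpow_le_rpow_of_exponent_ge' hy h (K.cast_nonneg.trans hKc) hcK
  · calc binomialRemainder (K + 1) n x ≤ (n * x) ^ K := binomialRemainder_succ_le_pow K n hx
      _ = (n * x) ^ (K : ℝ) := (Real.rpow_natCast _ _).symm
      _ ≤ (n * x) ^ c := Real.rpow_le_rpow_of_exponent_le h hKc

section PowerSums

variable {ι : Type*} {a : ι → ℂ} {x : ι → ℝ} {K : ℕ} {c : ℝ} {s : ℂ}

lemma summable_mul_newtonCoeff_mul_pochhammerNewton (hx : ∀ i, x i ∈ Set.Icc 0 1) (hKc : K ≤ c)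
    (hcK : c ≤ K + 1) (hcs : c < s.re) (ha : Summable fun i => ‖a i‖ * x i ^ c) :
    Summable fun p : ℕ × ι =>
      a p.2 * newtonCoeff ((Set.Ici (K + 1)).indicator fun k => (x p.2 : ℂ) ^ k) p.1 *
        pochhammerNewton p.1 s := by
  have hprod := (summable_rpow_mul_norm_pochhammerNewton hcs).mul_of_nonneg ha
    (fun n => by positivity) (fun i => mul_nonneg (norm_nonneg _) (Real.rpow_nonneg (hx i).1 _))
  refine hprod.of_norm_bounded fun ⟨n, i⟩ => ?_
  have hle := binomialRemainder_succ_le_rpow n (hx i) hKc hcK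
  rw [newtonCoeff_indicator_Ici_pow, norm_mul, norm_mul, norm_mul, norm_pow, norm_neg, norm_one,
    one_pow, one_mul, Complex.norm_real, Real.norm_of_nonneg (binomialRemainder_nonneg _ n (hx i))]
  calc ‖a i‖ * binomialRemainder (K + 1) n (x i) * ‖pochhammerNewton n s‖
      ≤ ‖a i‖ * ((n : ℝ) ^ c * x i ^ c) * ‖pochhammerNewton n s‖ := by gcongr
    _ = (n : ℝ) ^ c * ‖pochhammerNewton n s‖ * (‖a i‖ * x i ^ c) := by ring

theorem hasSum_newtonCoeff_mul_pochhammerNewton {f : ℕ → ℂ} {L : ℂ}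
    (hx : ∀ i, x i ∈ Set.Icc 0 1) (hKc : K ≤ c) (hcK : c ≤ K + 1) (hcs : c < s.re)
    (ha : Summable fun i => ‖a i‖ * x i ^ c)
    (hf : ∀ k : ℕ, K < k → HasSum (fun i => a i * (x i : ℂ) ^ k) (f k))
    (hL : HasSum (fun i => a i * (x i : ℂ) ^ s) L) :
    HasSum (fun n => newtonCoeff f n * pochhammerNewton n s) L := by
  have hs : 0 < s.re := (K.cast_nonneg.trans hKc).trans_lt hcs
  have hK : ∀ k < K + 1, (k : ℝ) < s.re := fun k hk =>
    (Nat.cast_le.mpr (Nat.lt_succ_iff.mp hk)).trans_lt (hKc.trans_lt hcs)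
  rw [← hasSum_newtonCoeff_indicator_Ici_iff hK]
  have hdouble := (summable_mul_newtonCoeff_mul_pochhammerNewton hx hKc hcK hcs ha).hasSum
  have htail (k : ℕ) :
      HasSum (fun i => a i * (Set.Ici (K + 1)).indicator (fun k => (x i : ℂ) ^ k) k)
        ((Set.Ici (K + 1)).indicator f k) := by
    by_cases hk : k ∈ Set.Ici (K + 1)
    · simpa only [Set.indicator_of_mem hk] using hf k hk
    · simpa only [Set.indicator_of_notMem hk, mul_zero] using hasSum_zero
  have hrow (n : ℕ) := (hasSum_newtonCoeff htail n).mul_right (pochhammerNewton n s)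
  have hcol (i : ι) := ((hasSum_newtonCoeff_indicator_Ici_iff hK).mpr
    (hasSum_newtonCoeff_pow_mul_pochhammerNewton hs (hx i))).mul_left (a i)
  simp only [newtonCoeff_const_mul] at hrow
  simp only [← mul_assoc] at hcol
  have hrows := hdouble.prod_fiberwise hrow
  have hcols := ((Equiv.prodComm ι ℕ).hasSum_iff.mpr hdouble).prod_fiberwise hcol
  rwa [hcols.unique hL] at hrows

end PowerSums

lemma LSeries_term_eq_mul_inv_cpow (a : ℕ → ℂ) {s : ℂ} (hs : s ≠ 0) (m : ℕ) :
    LSeries.term a s m = a m * (((m : ℝ)⁻¹ : ℝ) : ℂ) ^ s := by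
  rw [LSeries.term_of_ne_zero' hs, Complex.ofReal_inv, Complex.ofReal_natCast,
    Complex.inv_cpow _ _ (by rw [Complex.natCast_arg]; exact Real.pi_pos.ne), div_eq_mul_inv]

lemma hasSum_mul_inv_cpow_LSeries {a : ℕ → ℂ} {s : ℂ} (hs : s ≠ 0)
    (ha : LSeries.abscissaOfAbsConv a < s.re) :
    HasSum (fun m : ℕ => a m * (((m : ℝ)⁻¹ : ℝ) : ℂ) ^ s) (LSeries a s) := by
  simp only [← LSeries_term_eq_mul_inv_cpow a hs]
  exact (LSeriesSummable_of_abscissaOfAbsConv_lt_re ha).LSeriesHasSum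

lemma summable_norm_mul_inv_rpow {a : ℕ → ℂ} {c : ℝ} (hc : c ≠ 0)
    (ha : LSeries.abscissaOfAbsConv a < c) :
    Summable fun m : ℕ => ‖a m‖ * ((m : ℝ)⁻¹) ^ c := by
  have h := (hasSum_mul_inv_cpow_LSeries (s := c) (by exact_mod_cast hc) ha).summable.norm
  simpa only [norm_mul, Complex.norm_cpow_eq_rpow_re_of_nonneg (inv_nonneg.mpr (Nat.cast_nonneg _))
    (show (c : ℂ).re ≠ 0 from hc), Complex.ofReal_re] using h

theorem corollaryC_general {a f : ℕ → ℂ} {s : ℂ} (hs : 0 < s.re)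
    (ha : LSeries.abscissaOfAbsConv a < s.re)
    (hf : ∀ k : ℕ, s.re ≤ k → f k = LSeries a k) :
    HasSum (fun n => newtonCoeff f n * pochhammerNewton n s) (LSeries a s) := by
  obtain ⟨K, hK⟩ := Nat.exists_eq_add_one.mpr (Nat.ceil_pos.mpr hs)
  have hKs : K < s.re := Nat.lt_ceil.mp (by lia)
  have hsK : s.re ≤ K + 1 := by exact_mod_cast hK ▸ Nat.le_ceil s.re
  obtain ⟨c, hc, hcs⟩ := EReal.lt_iff_exists_real_btwn.mp
    (max_lt ha (EReal.coe_lt_coe_iff.mpr hKs))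
  obtain ⟨hac, hKc⟩ := max_lt_iff.mp hc
  rw [EReal.coe_lt_coe_iff] at hKc hcs
  have hc0 : c ≠ 0 := (K.cast_nonneg.trans_lt hKc).ne'
  refine hasSum_newtonCoeff_mul_pochhammerNewton
    (fun m => ⟨inv_nonneg.mpr m.cast_nonneg, Nat.cast_inv_le_one m⟩) hKc.le (hcs.le.trans hsK) hcs
    (summable_norm_mul_inv_rpow hc0 hac) (fun k hk => ?_)
    (hasSum_mul_inv_cpow_LSeries (by rintro rfl; simp at hs) ha)
  have hsk : s.re ≤ k := hsK.trans (by exact_mod_cast hk)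
  have hk0 : (k : ℂ) ≠ 0 := by exact_mod_cast (by lia : k ≠ 0)
  rw [hf k hsk]
  simpa only [Complex.cpow_natCast] using
    hasSum_mul_inv_cpow_LSeries hk0 (ha.trans_le (EReal.coe_le_coe (by simpa using hsk)))

lemma LSeries_moebius_eq_one_div_riemannZeta {s : ℂ} (hs : 1 < s.re) :
    LSeries (fun n => (ArithmeticFunction.moebius n : ℂ)) s = 1 / riemannZeta s :=
  eq_one_div_of_mul_eq_one_right
    (LSeries_one_eq_riemannZeta hs ▸ LSeries_one_mul_Lseries_moebius hs)

lemma recipZeta_eq_LSeries_moebius {s : ℂ} (hs : 1 < s.re) :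
    recipZeta s = LSeries (fun n => (ArithmeticFunction.moebius n : ℂ)) s := by
  have hs1 : s ≠ 1 := by rintro rfl; simp at hs
  rw [recipZeta, if_neg hs1, LSeries_moebius_eq_one_div_riemannZeta hs]

theorem corollaryC (s : ℂ) (hs : 1 < s.re) :
    HasSum
      (fun n : ℕ =>
        (∑ k ∈ Finset.range (n + 1), pochhammerNewton k (n : ℂ) * recipZeta (k : ℂ)) *
          pochhammerNewton n s)
      (1 / riemannZeta s) := by
  rw [← LSeries_moebius_eq_one_div_riemannZeta hs]
  refine corollaryC_general (f := fun k => recipZeta k) (by linarith) ?_ fun k hk =>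
    recipZeta_eq_LSeries_moebius (by simpa using hs.trans_le hk)
  rw [ArithmeticFunction.abscissaOfAbsConv_moebius]
  exact_mod_cast hs
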